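/- Let $G$ be a finite simple graph of even order $2n$ with vertex set $V$. Call $G$ *degree-equipartite* if for every $n$-element set $A\subseteq V$ the induced subgraphs $G[A]$ and $G[V\setminus A]$ have the same degree sequence (as multisets); *weakly equipartite* if for every $n$-element set $A\subseteq V$ the graphs $G[A]$ and $G[V\setminus A]$ are isomorphic; and *equipartite* if for every $n$-element set $A\subseteq V$ there is an automorphism of $G$ mapping $A$ onto $V\setminus A$. Then $G$ is degree-equipartite if and only if it is weakly equipartite. Moreover, every degree-equipartite graph is equipartite. -/

import Mathlib

namespace SimpleGraph

/-- The degree sequence of a finite graph, as the multiset of the degrees of its vertices. -/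
def degreeSeq {W : Type*} [Fintype W] (H : SimpleGraph W) [DecidableRel H.Adj] : Multiset ℕ :=
  Finset.univ.val.map fun w : W => H.degree w

variable {V : Type*} [Fintype V] [DecidableEq V]

/-- `A` is one of the two parts of a bisection `(A, V ∖ A)`: both parts have equally many
vertices. -/
def IsBisection (A : Finset V) : Prop :=
  A.card = Aᶜ.card

/-- For every bisection `(A, V ∖ A)`, the induced subgraphs `G[A]` and `G[V ∖ A]` have the same
degree sequence. -/
def IsDegreeEquipartite (G : SimpleGraph V) [DecidableRel G.Adj] : Prop :=
  ∀ A : Finset V, IsBisection A →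
    (G.induce {v | v ∈ A}).degreeSeq = (G.induce {v | v ∈ Aᶜ}).degreeSeq

/-- For every bisection `(A, V ∖ A)`, the induced subgraphs `G[A]` and `G[V ∖ A]` are
isomorphic. -/
def IsWeaklyEquipartite (G : SimpleGraph V) : Prop :=
  ∀ A : Finset V, IsBisection A →
    Nonempty (G.induce {v | v ∈ A} ≃g G.induce {v | v ∈ Aᶜ})

/-- For every bisection `(A, V ∖ A)`, some automorphism of `G` maps `A` onto `V ∖ A`. -/
def IsEquipartite (G : SimpleGraph V) : Prop :=
  ∀ A : Finset V, IsBisection A →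
    ∃ f : G ≃g G, f '' {v | v ∈ A} = {v | v ∈ Aᶜ}

end SimpleGraph

/-! An automorphism exchanging `A` and its complement restricts to an isomorphism of the two induced
graphs, and isomorphic graphs have equal degree sequences. So everything rests on
`IsDegreeEquipartite.isEquipartite`, which classifies the degree-equipartite graphs.

Encode a bisection as a balanced labelling `x` with values ±1. Then `deg v + x v * neighborSum x v`
is twice the degree of `v` inside its own part, so `∑ x v * F (deg v + x v * neighborSum x v) = 0`
for every `F` (`IsDegreeEquipartite.sum_signed_eq_zero`). Linear `F` forces `G` to be `d`-regular.
Quadratic `F` then gives a vanishing cubic form, and polarizing it gives an alternating identity on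
six vertices (`IsDegreeEquipartite.six_point`). Averaging removes one vertex at a time, until the
number of cherries in a triple is expressed by its edges and codegrees
(`IsDegreeEquipartite.triple_formula`).

Passing to the complement if necessary, assume `d < n`. The triple formula, applied around two
disjoint closed neighbourhoods, leaves only the empty graph, a perfect matching, two disjoint
cliques `K_n`, `K_{n,n}` minus a perfect matching, and two disjoint 4-cycles. In each case the
required automorphism is constructed. -/

namespace SimpleGraph

open Finset

/-! ### Bisections as ±1 labellings: regularity and the six-vertex identity. -/

section Reformulation

variable {V : Type*} [Fintype V] [DecidableEq V] (G : SimpleGraph V) [DecidableRel G.Adj]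

/-- The number of neighbours of `v` in `A`. -/
def degreeIn (A : Finset V) (v : V) : ℕ := #(G.neighborFinset v ∩ A)

lemma degreeSeq_induce (A : Finset V) :
    (G.induce {v | v ∈ A}).degreeSeq = A.val.map (G.degreeIn A) := by
  have h1 : ∀ w : {v // v ∈ {v | v ∈ A}},
      (G.induce {v | v ∈ A}).degree w = G.degreeIn A w.1 := by
    intro w
    have := congrArg Finset.card (G.map_neighborFinset_induce (s := {v | v ∈ A}) w)
    rw [card_map, card_neighborFinset_eq_degree] at this
    refine Eq.trans ?_ (this.trans ?_)
    · congr!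
    · rw [degreeIn]
      congr 2
      ext; simp
  unfold degreeSeq
  rw [show (fun w : {v // v ∈ {v | v ∈ A}} => (G.induce {v | v ∈ A}).degree w) =
    (G.degreeIn A) ∘ Subtype.val from funext h1, ← Multiset.map_map]
  congr 1
  have : (Finset.univ : Finset {v // v ∈ {v | v ∈ A}}).map (Function.Embedding.subtype _) = A := by
    ext; simp
  exact congrArg Finset.val this

variable {G}

lemma isDegreeEquipartite_iff : G.IsDegreeEquipartite ↔ ∀ A : Finset V, IsBisection A →
    A.val.map (G.degreeIn A) = Aᶜ.val.map (G.degreeIn Aᶜ) := by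
  unfold IsDegreeEquipartite
  simp only [degreeSeq_induce]

/-- The signed neighbour sum of the labelling `x` at `v`. -/
def neighborSum (G : SimpleGraph V) [DecidableRel G.Adj] (x : V → ℤ) (v : V) : ℤ :=
  ∑ u ∈ G.neighborFinset v, x u

lemma neighborSum_eq (x : V → ℤ) (hx : ∀ v, x v = 1 ∨ x v = -1) (v : V) :
    G.neighborSum x v = G.degreeIn (univ.filter (x · = 1)) v - G.degreeIn (univ.filter (x · = 1))ᶜ v ∧
    (G.degree v : ℤ) = G.degreeIn (univ.filter (x · = 1)) v + G.degreeIn (univ.filter (x · = 1))ᶜ v := by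
  have e : ∀ f : V → ℤ, ∑ u ∈ G.neighborFinset v, f u =
      ∑ u ∈ G.neighborFinset v ∩ (univ.filter (x · = 1)), f u +
      ∑ u ∈ G.neighborFinset v ∩ (univ.filter (x · = 1))ᶜ, f u := by
    intro f
    rw [← Finset.sum_union]
    · rw [← Finset.inter_union_distrib_left, Finset.union_compl, Finset.inter_univ]
    · exact Finset.disjoint_left.2 fun a ha hb => by simp_all
  constructor
  · rw [neighborSum, e, Finset.sum_congr rfl (g := fun _ => (1 : ℤ)),
      Finset.sum_congr (s₁ := G.neighborFinset v ∩ (univ.filter (x · = 1))ᶜ) rfl (g := fun _ => (-1 : ℤ))]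
    · simp [degreeIn, sub_eq_add_neg]
    · intro u hu
      have := hx u
      simp_all
    · intro u hu
      simp_all
  · have := e fun _ => 1
    simpa [degreeIn] using this

/-- The argument of `F` is twice the degree of `v` within its own part, so the two parts contribute
the same sum of `F`-values with opposite signs. -/
lemma IsDegreeEquipartite.sum_signed_eq_zero (h : G.IsDegreeEquipartite) (F : ℤ → ℤ)
    (x : V → ℤ) (hx : ∀ v, x v = 1 ∨ x v = -1) (h0 : ∑ v, x v = 0) :
    ∑ v, x v * F (G.degree v + x v * G.neighborSum x v) = 0 := by
  set A : Finset V := {u | x u = 1} with hA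
  have hmA : ∀ v ∈ A, x v = 1 := fun v hv => by simpa [hA] using hv
  have hmA' : ∀ v ∈ Aᶜ, x v = -1 := fun v hv => by
    have := hx v
    simp_all
  have hb : IsBisection A := by
    rw [← Finset.sum_add_sum_compl A, Finset.sum_congr rfl hmA, Finset.sum_congr rfl hmA'] at h0
    simp only [sum_const, nsmul_eq_mul] at h0
    unfold IsBisection
    lia
  have key := congrArg (fun s => (s.map fun k : ℕ => F (2 * k)).sum)
    (isDegreeEquipartite_iff.1 h A hb)
  simp only [Multiset.map_map, Function.comp_def] at key
  change ∑ v ∈ A, F (2 * G.degreeIn A v) = ∑ v ∈ Aᶜ, F (2 * G.degreeIn Aᶜ v) at key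
  have e1 : ∑ v ∈ A, x v * F (G.degree v + x v * G.neighborSum x v) =
      ∑ v ∈ A, F (2 * G.degreeIn A v) := by
    refine Finset.sum_congr rfl fun v hv => ?_
    obtain ⟨h1, h2⟩ := neighborSum_eq (G := G) x hx v
    rw [hmA v hv, h1, h2, ← hA]
    ring_nf
  have e2 : ∑ v ∈ Aᶜ, x v * F (G.degree v + x v * G.neighborSum x v) =
      ∑ v ∈ Aᶜ, -F (2 * G.degreeIn Aᶜ v) := by
    refine Finset.sum_congr rfl fun v hv => ?_
    obtain ⟨h1, h2⟩ := neighborSum_eq (G := G) x hx v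
    rw [hmA' v hv, h1, h2, ← hA]
    ring_nf
  rw [← Finset.sum_add_sum_compl A, e1, e2, key]
  simp

/-- Provides a fixed background labelling off `S`, so that signs on `S` can be varied in balanced
pairs. -/
lemma exists_balanced (S : Finset V) (hS : Even #Sᶜ) :
    ∃ y : V → ℤ, (∀ v ∈ S, y v = 0) ∧ (∀ v ∉ S, y v = 1 ∨ y v = -1) ∧ ∑ v, y v = 0 := by
  obtain ⟨k, hk⟩ := hS
  obtain ⟨T, hT, hc⟩ := Finset.exists_subset_card_eq (s := Sᶜ) (n := k) (by omega)
  refine ⟨fun v => if v ∈ S then 0 else if v ∈ T then 1 else -1, by simp +contextual, ?_, ?_⟩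
  · intro v hv
    by_cases h : v ∈ T <;> simp [hv, h]
  · rw [← Finset.sum_add_sum_compl S,
      Finset.sum_congr rfl (g := fun _ => (0 : ℤ)) (by simp +contextual),
      ← Finset.sum_sdiff hT,
      Finset.sum_congr (s₁ := T) rfl (g := fun _ => (1 : ℤ)),
      Finset.sum_congr (s₁ := Sᶜ \ T) rfl (g := fun _ => (-1 : ℤ))]
    · have := Finset.card_sdiff_add_card_eq_card hT
      simp only [sum_const, nsmul_eq_mul]
      lia
    · intro v hv
      simp_all
    · intro v hv
      have := hT hv
      simp_all

omit [DecidableEq V] in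
lemma sum_neighborSum (x : V → ℤ) : ∑ v, G.neighborSum x v = ∑ v, x v * G.degree v := by
  unfold neighborSum
  simp only [neighborFinset_eq_filter, Finset.sum_filter]
  rw [Finset.sum_comm]
  refine Finset.sum_congr rfl fun v _ => ?_
  simp_rw [G.adj_comm _ v]
  rw [← Finset.sum_filter, ← neighborFinset_eq_filter]
  simp [mul_comm]

lemma IsDegreeEquipartite.sum_mul_degree_eq_zero (h : G.IsDegreeEquipartite)
    (x : V → ℤ) (hx : ∀ v, x v = 1 ∨ x v = -1) (h0 : ∑ v, x v = 0) :
    ∑ v, x v * (G.degree v : ℤ) = 0 := by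
  -- Since `x v ^ 2 = 1`, the choice `F = id` yields the degree sum plus the total of the neighbour
  -- sums, and by double counting these two agree.
  have h1 := h.sum_signed_eq_zero id x hx h0
  have h2 : ∀ v, x v * id (G.degree v + x v * G.neighborSum x v) =
      x v * G.degree v + G.neighborSum x v := by
    intro v
    rcases hx v with h | h <;> rw [h] <;> simp only [id] <;> ring
  rw [Finset.sum_congr rfl fun v _ => h2 v, Finset.sum_add_distrib, sum_neighborSum] at h1
  lia

/-- The vector `e_a - e_b`. -/
def diffVec (a b : V) : V → ℤ := Pi.single a 1 - Pi.single b 1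

omit [Fintype V] in
lemma diffVec_apply (a b v : V) :
    diffVec a b v = (if v = a then 1 else 0) - (if v = b then 1 else 0) := by
  simp [diffVec, Pi.single_apply]

lemma sum_diffVec_mul (a b : V) (f : V → ℤ) : ∑ v, diffVec a b v * f v = f a - f b := by
  simp [diffVec_apply, sub_mul, Finset.sum_sub_distrib]

lemma sum_diffVec (a b : V) : ∑ v, diffVec a b v = 0 := by
  simpa using sum_diffVec_mul a b fun _ => 1

/-- Exchanging the labels of `a` and `b` changes the signed degree sum by twice the difference of
their degrees, yet both sums vanish. -/
lemma IsDegreeEquipartite.degree_eq (h : G.IsDegreeEquipartite) (hV : Even (Fintype.card V))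
    (a b : V) : G.degree a = G.degree b := by
  by_cases hab : a = b
  · rw [hab]
  obtain ⟨y, y0, y1, ys⟩ := exists_balanced {a, b} (by
    rw [Finset.card_compl, Finset.card_pair hab]
    exact hV.tsub even_two)
  have key : ∀ s : ℤ, s = 1 ∨ s = -1 →
      ∑ v, y v * (G.degree v : ℤ) + s * (G.degree a - G.degree b) = 0 := by
    intro s hs
    have := h.sum_mul_degree_eq_zero (fun v => y v + s * diffVec a b v) (by
      intro v
      by_cases hva : v = a
      · subst hva
        simp [y0, diffVec_apply, hab, hs]
      by_cases hvb : v = b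
      · subst hvb
        simp only [mem_insert, mem_singleton, or_true, y0, diffVec_apply, hva]
        rcases hs with rfl | rfl <;> simp
      simpa [diffVec_apply, hva, hvb] using y1 v (by simp [hva, hvb])) (by
      rw [Finset.sum_add_distrib, ys, ← Finset.mul_sum, sum_diffVec]; simp)
    simp only [add_mul, Finset.sum_add_distrib, mul_assoc, ← Finset.mul_sum, sum_diffVec_mul] at this
    exact this
  have h1 := key 1 (by simp)
  have h2 := key (-1) (by simp)
  lia

omit [DecidableEq V] in
lemma neighborSum_add (x y : V → ℤ) (v : V) :
    G.neighborSum (fun u => x u + y u) v = G.neighborSum x v + G.neighborSum y v :=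
  Finset.sum_add_distrib

omit [DecidableEq V] in
lemma neighborSum_mul (s : ℤ) (x : V → ℤ) (v : V) :
    G.neighborSum (fun u => s * x u) v = s * G.neighborSum x v :=
  (Finset.mul_sum ..).symm

/-- The adjacency indicator. -/
def adjInd (G : SimpleGraph V) [DecidableRel G.Adj] (a b : V) : ℤ := if G.Adj a b then 1 else 0

omit [Fintype V] [DecidableEq V] in
lemma adjInd_comm (a b : V) : G.adjInd a b = G.adjInd b a := by
  simp [adjInd, G.adj_comm]

lemma neighborSum_diffVec (a b v : V) :
    G.neighborSum (diffVec a b) v = G.adjInd v a - G.adjInd v b := by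
  simp [neighborSum, diffVec_apply, Finset.sum_sub_distrib, adjInd]

lemma IsDegreeEquipartite.sum_mul_neighborSum_sq_eq_zero (h : G.IsDegreeEquipartite)
    {d : ℕ} (hd : ∀ v, G.degree v = d)
    (x : V → ℤ) (hx : ∀ v, x v = 1 ∨ x v = -1) (h0 : ∑ v, x v = 0) :
    ∑ v, x v * G.neighborSum x v ^ 2 = 0 := by
  have h1 := h.sum_signed_eq_zero (fun k => (k - d) ^ 2) x hx h0
  rw [← h1]
  refine Finset.sum_congr rfl fun v _ => ?_
  rw [hd v]
  rcases hx v with h | h <;> rw [h] <;> ring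

/-- The number of pairs of edges spanned by `{a, b, c}`, for distinct `a`, `b`, `c`. -/
def cherryCount (G : SimpleGraph V) [DecidableRel G.Adj] (a b c : V) : ℤ :=
  G.adjInd a b * G.adjInd a c + G.adjInd a b * G.adjInd b c + G.adjInd a c * G.adjInd b c

/-- This is the trilinear part of the cubic form `∑ x v * neighborSum x v ^ 2` in the directions
`e_a - e_a'`, `e_b - e_b'`, `e_c - e_c'`. Exchanging labels within each pair keeps the labelling
balanced, so all eight sign choices are zeros of the form. -/
lemma IsDegreeEquipartite.six_point (h : G.IsDegreeEquipartite) (hV : Even (Fintype.card V))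
    {d : ℕ} (hd : ∀ v, G.degree v = d) (a a' b b' c c' : V)
    (hn : [a, a', b, b', c, c'].Nodup) :
    G.cherryCount a b c - G.cherryCount a' b c - G.cherryCount a b' c + G.cherryCount a' b' c
      - G.cherryCount a b c' + G.cherryCount a' b c' + G.cherryCount a b' c'
      - G.cherryCount a' b' c' = 0 := by
  obtain ⟨y, y0, y1, ys⟩ := exists_balanced [a, a', b, b', c, c'].toFinset (by
    rw [Finset.card_compl, List.toFinset_card_of_nodup hn]
    exact hV.tsub (by decide : Even 6))
  have key : ∀ s t r : ℤ, (s = 1 ∨ s = -1) → (t = 1 ∨ t = -1) → (r = 1 ∨ r = -1) →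
      ∑ v, (y v + s * diffVec a a' v + t * diffVec b b' v + r * diffVec c c' v) *
        (G.neighborSum y v + s * G.neighborSum (diffVec a a') v
          + t * G.neighborSum (diffVec b b') v + r * G.neighborSum (diffVec c c') v) ^ 2 = 0 := by
    intro s t r hs ht hr
    have := h.sum_mul_neighborSum_sq_eq_zero hd
      (fun v => y v + s * diffVec a a' v + t * diffVec b b' v + r * diffVec c c' v) (by
      intro v
      by_cases hv : v ∈ [a, a', b, b', c, c']
      · rw [y0 v (by simpa using hv)]
        simp only [diffVec_apply]
        simp only [List.nodup_cons, List.mem_cons, not_or, List.not_mem_nil] at hn hv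
        by_cases h1 : v = a
        · subst h1
          rcases hs with rfl | rfl <;> simp [hn]
        by_cases h2 : v = a'
        · subst h2
          rcases hs with rfl | rfl <;> simp [hn, h1]
        by_cases h3 : v = b
        · subst h3
          rcases ht with rfl | rfl <;> simp [hn, h1, h2]
        by_cases h4 : v = b'
        · subst h4
          rcases ht with rfl | rfl <;> simp [hn, h1, h2, h3]
        by_cases h5 : v = c
        · subst h5
          rcases hr with rfl | rfl <;> simp [hn, h1, h2, h3, h4]
        by_cases h6 : v = c'
        · subst h6
          rcases hr with rfl | rfl <;> simp [h1, h2, h3, h4, h5]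
        simp_all
      · have := y1 v (by simpa using hv)
        simp only [List.mem_cons, not_or, List.not_mem_nil] at hv
        simpa [diffVec_apply, hv] using this) (by
      simp only [Finset.sum_add_distrib, ys, ← Finset.mul_sum, sum_diffVec]; simp)
    simpa only [neighborSum_add, neighborSum_mul] using this
  have pol : ∑ v, (diffVec a a' v *
        (G.neighborSum (diffVec b b') v * G.neighborSum (diffVec c c') v) +
      diffVec b b' v * (G.neighborSum (diffVec a a') v * G.neighborSum (diffVec c c') v) +
      diffVec c c' v * (G.neighborSum (diffVec a a') v * G.neighborSum (diffVec b b') v)) = 0 := by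
    -- Weighting by `s * t * r` kills every monomial that is not odd in all three signs. The factor
    -- 16 is eight sign choices times the 2 from expanding the square.
    have e : ∀ v, 16 * (diffVec a a' v *
        (G.neighborSum (diffVec b b') v * G.neighborSum (diffVec c c') v) +
      diffVec b b' v * (G.neighborSum (diffVec a a') v * G.neighborSum (diffVec c c') v) +
      diffVec c c' v * (G.neighborSum (diffVec a a') v * G.neighborSum (diffVec b b') v)) =
      ∑ s ∈ ({1, -1} : Finset ℤ), ∑ t ∈ ({1, -1} : Finset ℤ), ∑ r ∈ ({1, -1} : Finset ℤ),
      s * t * r * ((y v + s * diffVec a a' v + t * diffVec b b' v + r * diffVec c c' v) *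
        (G.neighborSum y v + s * G.neighborSum (diffVec a a') v
          + t * G.neighborSum (diffVec b b') v + r * G.neighborSum (diffVec c c') v) ^ 2) := by
      intro v
      have hne : (1 : ℤ) ∉ ({-1} : Finset ℤ) := by decide
      simp only [Finset.sum_insert hne, Finset.sum_singleton]
      ring
    have e2 : 16 * ∑ v, (diffVec a a' v *
        (G.neighborSum (diffVec b b') v * G.neighborSum (diffVec c c') v) +
      diffVec b b' v * (G.neighborSum (diffVec a a') v * G.neighborSum (diffVec c c') v) +
      diffVec c c' v * (G.neighborSum (diffVec a a') v * G.neighborSum (diffVec b b') v)) = 0 := by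
      rw [Finset.mul_sum, Finset.sum_congr rfl fun v _ => e v, Finset.sum_comm]
      refine Finset.sum_eq_zero fun s hs => ?_
      rw [Finset.sum_comm]
      refine Finset.sum_eq_zero fun t ht => ?_
      rw [Finset.sum_comm]
      refine Finset.sum_eq_zero fun r hr => ?_
      rw [← Finset.mul_sum, key s t r (by simpa using hs) (by simpa using ht) (by simpa using hr),
        mul_zero]
    lia
  simp only [Finset.sum_add_distrib, sum_diffVec_mul, neighborSum_diffVec] at pol
  rw [← pol]
  simp only [cherryCount, adjInd_comm b a, adjInd_comm b a', adjInd_comm b' a, adjInd_comm b' a',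
    adjInd_comm c a, adjInd_comm c a', adjInd_comm c' a, adjInd_comm c' a',
    adjInd_comm c b, adjInd_comm c b', adjInd_comm c' b, adjInd_comm c' b']
  ring

end Reformulation

/-! ### Recovering a symmetric function of triples from its pair sums. -/

section Averaging

variable {V : Type*} [Fintype V] [DecidableEq V]

lemma sum_eq_sum_compl_of_nodup {M : Type*} [AddCommMonoid M] (f : V → M) {a b c d : V}
    (hn : [a, b, c, d].Nodup) :
    ∑ z, f z = ∑ z ∈ ({a, b, c, d} : Finset V)ᶜ, f z + (f a + (f b + (f c + f d))) := by
  simp only [List.nodup_cons, List.mem_cons, not_or, List.not_mem_nil] at hn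
  rw [← Finset.sum_compl_add_sum ({a, b, c, d} : Finset V)]
  rw [Finset.sum_insert (s := {b, c, d}) (by simp [hn]), Finset.sum_insert (by simp [hn]),
    Finset.sum_insert (by simp [hn]), Finset.sum_singleton]

lemma card_compl_of_nodup {a b c d : V} (hn : [a, b, c, d].Nodup) :
    (#({a, b, c, d} : Finset V)ᶜ : ℤ) = Fintype.card V - 4 := by
  have := sum_eq_sum_compl_of_nodup (fun _ => (1 : ℤ)) hn
  simp only [sum_const, nsmul_eq_mul, card_univ] at this
  lia

variable {φ : V → V → V → ℤ} (s12 : ∀ a b c, φ a b c = φ b a c) (s23 : ∀ a b c, φ a b c = φ a c b)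
  (hz : ∀ a b, φ a a b = 0)
  (six : ∀ a a' b b' c c', [a, a', b, b', c, c'].Nodup → φ a b c - φ a' b c - φ a b' c + φ a' b' c
      - φ a b c' + φ a' b c' + φ a b' c' - φ a' b' c' = 0)

-- The second difference in `a, a'` and `b, b'` is the same at every third vertex outside these
-- four, so it equals its average there.
include s12 s23 hz six in
lemma five_point {a a' b b' c : V} (hn : [a, a', b, b', c].Nodup) :
    ((Fintype.card V : ℤ) - 4) * (φ a b c - φ a' b c - φ a b' c + φ a' b' c) =
      ∑ z, φ a b z - ∑ z, φ a' b z - ∑ z, φ a b' z + ∑ z, φ a' b' z := by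
  have hn4 : [a, a', b, b'].Nodup := by
    simp only [List.nodup_cons, List.mem_cons, not_or, List.not_mem_nil] at hn ⊢
    tauto
  have h1 : ∑ z ∈ ({a, a', b, b'} : Finset V)ᶜ, (φ a b z - φ a' b z - φ a b' z + φ a' b' z) =
      ∑ z ∈ ({a, a', b, b'} : Finset V)ᶜ, (φ a b c - φ a' b c - φ a b' c + φ a' b' c) := by
    refine Finset.sum_congr rfl fun z hz' => ?_
    by_cases hzc : z = c
    · rw [hzc]
    have := six a a' b b' c z (by
      simp only [List.nodup_cons, List.mem_cons, not_or, List.not_mem_nil] at hn ⊢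
      simp only [mem_compl, mem_insert, mem_singleton, not_or] at hz'
      simp_all [eq_comm])
    lia
  rw [Finset.sum_const, nsmul_eq_mul, card_compl_of_nodup hn4] at h1
  have h2 := sum_eq_sum_compl_of_nodup (fun z => φ a b z - φ a' b z - φ a b' z + φ a' b' z) hn4
  rw [h1] at h2
  simp only [Finset.sum_add_distrib, Finset.sum_sub_distrib] at h2
  have z1 : ∀ u v, φ u v u = 0 := fun u v => by rw [s23, hz]
  have z2 : ∀ u v, φ u v v = 0 := fun u v => by rw [s12, z1]
  simp only [z1, z2] at h2
  have p13 : ∀ u v w, φ u v w = φ w v u := fun u v w => by rw [s12, s23, s12]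
  -- The four excluded values of `z` contribute nothing: `a` cancels `a'`, and `b` cancels `b'`.
  linear_combination -h2 + p13 a' b a - p13 a' b' a + s23 a b' b - s23 a' b' b

-- Sum the five-vertex identity over all admissible `b'`. The total `Γ` is the same for `a` and
-- `a'`, so it drops out.
include s12 s23 hz six in
lemma four_point (hN : 6 ≤ Fintype.card V) {Γ : ℤ} (hΓ : ∀ a, ∑ b, ∑ z, φ a b z = Γ)
    {a a' b c : V} (hn : [a, a', b, c].Nodup) :
    ((Fintype.card V : ℤ) - 4) * (φ a b c - φ a' b c) =
      ∑ z, φ a b z - ∑ z, φ a' b z + ∑ z, φ a c z - ∑ z, φ a' c z := by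
  have z1 : ∀ u v, φ u v u = 0 := fun u v => by rw [s23, hz]
  have z2 : ∀ u v, φ u v v = 0 := fun u v => by rw [s12, z1]
  have h1 : ∑ b' ∈ ({a, a', b, c} : Finset V)ᶜ,
        (((Fintype.card V : ℤ) - 4) * (φ a b c - φ a' b c - φ a b' c + φ a' b' c)) =
      ∑ b' ∈ ({a, a', b, c} : Finset V)ᶜ,
        (∑ z, φ a b z - ∑ z, φ a' b z - ∑ z, φ a b' z + ∑ z, φ a' b' z) := by
    refine Finset.sum_congr rfl fun b' hb' => ?_
    refine five_point s12 s23 hz six ?_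
    simp only [List.nodup_cons, List.mem_cons, not_or, List.not_mem_nil] at hn ⊢
    simp only [mem_compl, mem_insert, mem_singleton, not_or] at hb'
    simp_all [eq_comm]
  rw [← Finset.mul_sum] at h1
  simp only [Finset.sum_add_distrib, Finset.sum_sub_distrib, sum_const, nsmul_eq_mul,
    card_compl_of_nodup hn] at h1
  have e1 := sum_eq_sum_compl_of_nodup (fun z => φ a c z) hn
  have e2 := sum_eq_sum_compl_of_nodup (fun z => φ a' c z) hn
  have e3 := sum_eq_sum_compl_of_nodup (fun u => ∑ z, φ a u z) hn
  have e4 := sum_eq_sum_compl_of_nodup (fun u => ∑ z, φ a' u z) hn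
  simp only [hΓ, z1, z2, hz, Finset.sum_const_zero] at e1 e2 e3 e4
  simp only [s23 a _ c, s23 a' _ c] at h1
  have s1 : φ a' c a = φ a c a' := by rw [s23, s12, s23]
  have s2 : ∑ z, φ a' a z = ∑ z, φ a a' z := Finset.sum_congr rfl fun z _ => s12 ..
  rw [s1] at e2
  rw [s2] at e4
  rw [s23 a b c, s23 a' b c]
  -- After the summation both sides carry the factor `|V| - 3`.
  have hN' : ((Fintype.card V : ℤ) - 3) ≠ 0 := by lia
  refine mul_left_cancel₀ hN' ?_
  linear_combination h1 - ((Fintype.card V : ℤ) - 4) * (e1 - e2) + e3 - e4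

-- One more averaging, now over `a'`; here `Γ` enters twice, through the row sums of `b` and of `c`.
include s12 s23 hz six in
lemma three_point (hN : 6 ≤ Fintype.card V) {Γ : ℤ} (hΓ : ∀ a, ∑ b, ∑ z, φ a b z = Γ)
    {a b c : V} (hab : a ≠ b) (hac : a ≠ c) (hbc : b ≠ c) :
    ((Fintype.card V : ℤ) - 4) * ((Fintype.card V : ℤ) - 2) * φ a b c =
      ((Fintype.card V : ℤ) - 2) * (∑ z, φ a b z + ∑ z, φ a c z + ∑ z, φ b c z) - 2 * Γ := by
  have hs : ∀ f : V → ℤ, ∑ z, f z = ∑ z ∈ ({a, b, c} : Finset V)ᶜ, f z + (f a + (f b + f c)) := by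
    intro f
    rw [← Finset.sum_compl_add_sum ({a, b, c} : Finset V), Finset.sum_insert (by simp [hab, hac]),
      Finset.sum_insert (by simp [hbc]), Finset.sum_singleton]
  have hc : (#({a, b, c} : Finset V)ᶜ : ℤ) = Fintype.card V - 3 := by
    have := hs fun _ => 1
    simp only [sum_const, nsmul_eq_mul, card_univ] at this
    lia
  have z1 : ∀ u v, φ u v u = 0 := fun u v => by rw [s23, hz]
  have z2 : ∀ u v, φ u v v = 0 := fun u v => by rw [s12, z1]
  have h1 : ∑ a' ∈ ({a, b, c} : Finset V)ᶜ, (((Fintype.card V : ℤ) - 4) * (φ a b c - φ a' b c)) =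
      ∑ a' ∈ ({a, b, c} : Finset V)ᶜ,
        (∑ z, φ a b z - ∑ z, φ a' b z + ∑ z, φ a c z - ∑ z, φ a' c z) := by
    refine Finset.sum_congr rfl fun a' ha' => ?_
    refine four_point s12 s23 hz six hN hΓ ?_
    simp only [mem_compl, mem_insert, mem_singleton, not_or] at ha'
    simp_all [eq_comm]
  rw [← Finset.mul_sum] at h1
  simp only [Finset.sum_add_distrib, Finset.sum_sub_distrib, sum_const, nsmul_eq_mul, hc] at h1
  have e1 := hs fun u => φ b c u
  have e2 := hs fun u => ∑ z, φ b u z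
  have e3 := hs fun u => ∑ z, φ c u z
  simp only [hΓ, z1, z2, hz, Finset.sum_const_zero] at e1 e2 e3
  have s1 : ∀ u, φ u b c = φ b c u := fun u => by rw [s12, s23]
  have s2 : ∀ u v, ∑ z, φ u v z = ∑ z, φ v u z := fun u v => Finset.sum_congr rfl fun z _ => s12 ..
  have s3 : ∑ u ∈ ({a, b, c} : Finset V)ᶜ, φ u b c = ∑ u ∈ ({a, b, c} : Finset V)ᶜ, φ b c u :=
    Finset.sum_congr rfl fun u _ => s1 u
  have s4 : ∀ v, ∑ u ∈ ({a, b, c} : Finset V)ᶜ, ∑ z, φ u v z =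
      ∑ u ∈ ({a, b, c} : Finset V)ᶜ, ∑ z, φ v u z :=
    fun v => Finset.sum_congr rfl fun u _ => s2 u v
  rw [s3, s4 b, s4 c, s1 a] at h1
  rw [s1 a]
  rw [s2 b a] at e2
  rw [s2 c a, s2 c b] at e3
  linear_combination h1 - ((Fintype.card V : ℤ) - 4) * e1 + e2 + e3

end Averaging

/-! ### Cherries, codegrees and the triple formula. -/

section TripleFormula

variable {V : Type*} [Fintype V] [DecidableEq V] {G : SimpleGraph V} [DecidableRel G.Adj]

/-- The number of common neighbours of `a` and `b`, as an integer. -/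
def codegree (G : SimpleGraph V) [DecidableRel G.Adj] (a b : V) : ℤ :=
  #(G.neighborFinset a ∩ G.neighborFinset b)

lemma codegree_eq_sum (a b : V) : G.codegree a b = ∑ z, G.adjInd a z * G.adjInd b z := by
  simp only [codegree, adjInd, ← ite_and, mul_ite, mul_one, mul_zero]
  rw [Finset.sum_boole]
  congr 2
  ext z
  simp [and_comm]

omit [DecidableEq V] in
lemma sum_adjInd (a : V) : ∑ z, G.adjInd a z = G.degree a := by
  simp only [adjInd, Finset.sum_boole, ← card_neighborFinset_eq_degree]
  congr 2
  ext z
  simp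

omit [Fintype V] [DecidableEq V] in
lemma adjInd_self (a : V) : G.adjInd a a = 0 := by simp [adjInd]

omit [Fintype V] [DecidableEq V] in
lemma adjInd_mul_self (a b : V) : G.adjInd a b * G.adjInd a b = G.adjInd a b := by
  simp [adjInd]

/-- `cherryCount`, set to zero on triples that are not distinct. -/
def properCherryCount (G : SimpleGraph V) [DecidableRel G.Adj] (a b c : V) : ℤ :=
  if a = b ∨ a = c ∨ b = c then 0 else G.cherryCount a b c

/-- Summing the three products over all `z` gives the codegree and twice `d * adjInd a b`; the
degenerate terms `z = a` and `z = b` each remove one `adjInd a b`. -/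
lemma sum_properCherryCount {d : ℕ} (hd : ∀ v, G.degree v = d) {a b : V} (hab : a ≠ b) :
    ∑ z, G.properCherryCount a b z = G.codegree a b + 2 * (d - 1) * G.adjInd a b := by
  have h : ∀ z, G.properCherryCount a b z = G.cherryCount a b z
      - (if z = a then G.adjInd a b else 0) - (if z = b then G.adjInd a b else 0) := by
    intro z
    unfold properCherryCount cherryCount
    by_cases h1 : z = a
    · subst h1
      simp [hab, adjInd_self, adjInd_comm b z, adjInd_mul_self]
    by_cases h2 : z = b
    · subst h2
      simp [hab.symm, adjInd_self, adjInd_mul_self]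
    simp [hab, h1, h2, Ne.symm (a := z) h1, Ne.symm (a := z) h2]
  rw [Finset.sum_congr rfl fun z _ => h z]
  simp only [cherryCount, Finset.sum_sub_distrib, Finset.sum_add_distrib, ← Finset.mul_sum,
    sum_adjInd, hd, ← codegree_eq_sum]
  simp only [sum_ite_eq', mem_univ, if_true]
  ring

lemma sum_codegree {d : ℕ} (hd : ∀ v, G.degree v = d) (a : V) :
    ∑ b, G.codegree a b = d * d := by
  simp only [codegree_eq_sum]
  rw [Finset.sum_comm]
  simp only [← Finset.mul_sum, adjInd_comm _, sum_adjInd, hd]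
  simp only [← Finset.sum_mul, sum_adjInd, hd]

lemma codegree_self (a : V) : G.codegree a a = G.degree a := by
  simp [codegree]

lemma codegree_nonneg (a b : V) : 0 ≤ G.codegree a b := by
  simp [codegree]

lemma sum_sum_properCherryCount {d : ℕ} (hd : ∀ v, G.degree v = d) (a : V) :
    ∑ b, ∑ z, G.properCherryCount a b z = 3 * d * (d - 1) := by
  have h : ∀ b, ∑ z, G.properCherryCount a b z =
      G.codegree a b + 2 * (d - 1) * G.adjInd a b - if b = a then (d : ℤ) else 0 := by
    intro b
    by_cases hab : a = b
    · subst hab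
      simp [properCherryCount, adjInd_self, codegree_self, hd]
    · rw [sum_properCherryCount hd hab, if_neg (Ne.symm hab), sub_zero]
  rw [Finset.sum_congr rfl fun z _ => h z]
  simp only [Finset.sum_sub_distrib, Finset.sum_add_distrib, ← Finset.mul_sum,
    sum_adjInd, hd, sum_codegree hd, sum_ite_eq', mem_univ, if_true]
  ring

/-- The number of cherries in a triple is determined by the codegrees and the edges in it. -/
lemma IsDegreeEquipartite.triple_formula (h : G.IsDegreeEquipartite) {n : ℕ} (hn : 3 ≤ n)
    (hV : Fintype.card V = 2 * n) {d : ℕ} (hd : ∀ v, G.degree v = d) {a b c : V}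
    (hab : a ≠ b) (hac : a ≠ c) (hbc : b ≠ c) :
    2 * ((n : ℤ) - 2) * (n - 1) * G.cherryCount a b c =
      (n - 1) * (G.codegree a b + G.codegree a c + G.codegree b c +
        2 * (d - 1) * (G.adjInd a b + G.adjInd a c + G.adjInd b c)) - 3 * d * (d - 1) := by
  have key := three_point (φ := G.properCherryCount)
    (by
      intro a b c
      simp only [properCherryCount, cherryCount, adjInd_comm b a]
      congr 1
      · grind
      · ring)
    (by
      intro a b c
      simp only [properCherryCount, cherryCount, adjInd_comm c b]
      congr 1
      · grind
      · ring)
    (by simp [properCherryCount])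
    (by
      intro a a' b b' c c' hnd
      have := h.six_point (by rw [hV]; simp) hd a a' b b' c c' hnd
      rw [← this]
      simp only [List.nodup_cons, List.mem_cons, not_or, List.not_mem_nil] at hnd
      simp [properCherryCount, hnd])
    (by omega) (sum_sum_properCherryCount hd) hab hac hbc
  rw [sum_properCherryCount hd hab, sum_properCherryCount hd hac, sum_properCherryCount hd hbc,
    show G.properCherryCount a b c = G.cherryCount a b c by simp [properCherryCount, *], hV] at key
  push_cast at key
  refine mul_left_cancel₀ (two_ne_zero (α := ℤ)) ?_
  linear_combination key

end TripleFormula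

/-! ### Which regular graphs of degree less than `n` survive. -/

section Structure

variable {V : Type*} [Fintype V] [DecidableEq V] {G : SimpleGraph V} [DecidableRel G.Adj]

/-- In a degree-equipartite graph of small degree every closed neighbourhood is disjoint from
another one. -/
lemma IsDegreeEquipartite.exists_disjoint (h : G.IsDegreeEquipartite) {n : ℕ}
    (hV : Fintype.card V = 2 * n) {d : ℕ} (hd : ∀ v, G.degree v = d) (hdn : d + 1 ≤ n) (v : V) :
    ∃ w, v ≠ w ∧ ¬ G.Adj v w ∧ ∀ z, G.Adj v z → ¬ G.Adj w z := by
  -- With the closed neighbourhood of `v` inside `A`, the value `d` occurs in the degree sequence of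
  -- `A`. Hence some `w` in the complement keeps all its neighbours there.
  obtain ⟨A, hA, hc⟩ := Finset.exists_superset_card_eq (s := insert v (G.neighborFinset v))
    (n := n) (by
      rw [Finset.card_insert_of_notMem (by simp), card_neighborFinset_eq_degree, hd]
      exact hdn) (by omega)
  have hb : IsBisection A := by
    rw [IsBisection, Finset.card_compl]
    omega
  have key := isDegreeEquipartite_iff.1 h A hb
  have hNA : G.neighborFinset v ⊆ A := (Finset.subset_insert _ _).trans hA
  have h1 : d ∈ A.val.map (G.degreeIn A) := by
    refine Multiset.mem_map.2 ⟨v, hA (Finset.mem_insert_self _ _), ?_⟩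
    rw [degreeIn, Finset.inter_eq_left.2 hNA, card_neighborFinset_eq_degree, hd]
  rw [key] at h1
  obtain ⟨w, hw, hwd⟩ := Multiset.mem_map.1 h1
  have hwA : w ∉ A := by simpa using hw
  have hNw : G.neighborFinset w ⊆ Aᶜ := by
    rw [← Finset.inter_eq_left]
    refine Finset.eq_of_subset_of_card_le Finset.inter_subset_left ?_
    rw [card_neighborFinset_eq_degree, hd]
    exact hwd.ge
  have hvA : v ∈ A := hA (Finset.mem_insert_self _ _)
  refine ⟨w, fun e => hwA (e ▸ hvA), fun e => hwA (hNA (by simpa using e)), fun z hz hz' => ?_⟩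
  have h2 := hNA ((G.mem_neighborFinset v z).2 hz)
  have h3 := hNw ((G.mem_neighborFinset w z).2 hz')
  simp_all

lemma codegree_eq_zero_of_forall {a b : V} (h : ∀ z, G.Adj a z → ¬ G.Adj b z) :
    G.codegree a b = 0 := by
  simp only [codegree, Nat.cast_eq_zero, card_eq_zero]
  ext z
  simpa using h z

omit [Fintype V] [DecidableEq V] in
lemma adjInd_of_adj {a b : V} (h : G.Adj a b) : G.adjInd a b = 1 := if_pos h

omit [Fintype V] [DecidableEq V] in
lemma adjInd_of_not_adj {a b : V} (h : ¬ G.Adj a b) : G.adjInd a b = 0 := if_neg h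

lemma codegree_add_one_le {a b : V} (hab : G.Adj a b) : G.codegree a b + 1 ≤ G.degree a := by
  have : G.neighborFinset a ∩ G.neighborFinset b ⊂ G.neighborFinset a := by
    refine Finset.ssubset_iff_subset_ne.2 ⟨Finset.inter_subset_left, fun e => ?_⟩
    have : b ∈ G.neighborFinset a ∩ G.neighborFinset b := by rw [e]; simpa using hab
    simp at this
  have := Finset.card_lt_card this
  rw [card_neighborFinset_eq_degree] at this
  unfold codegree
  omega

lemma adj_of_codegree_eq {a b x : V} (hab : G.Adj a b) (hc : G.codegree a b + 1 = G.degree a)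
    (hax : G.Adj a x) (hxb : x ≠ b) : G.Adj b x := by
  by_contra hbx
  have hs : G.neighborFinset a ∩ G.neighborFinset b ⊆ G.neighborFinset a \ {b, x} := by
    intro y hy
    simp only [mem_inter, mem_neighborFinset, mem_sdiff, mem_insert, mem_singleton] at hy ⊢
    refine ⟨hy.1, ?_⟩
    rintro (rfl | rfl)
    · exact G.loopless.irrefl _ hy.2
    · exact hbx hy.2
  have h1 := Finset.card_le_card hs
  have hbx' : {b, x} ⊆ G.neighborFinset a := by
    intro y hy
    simp only [mem_insert, mem_singleton] at hy
    rcases hy with rfl | rfl <;> simpa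
  have h2 := Finset.card_le_card hbx'
  rw [Finset.card_sdiff_of_subset hbx'] at h1
  rw [Finset.card_pair hxb.symm, card_neighborFinset_eq_degree] at h1 h2
  unfold codegree at hc
  omega

/-- `X` and its complement are cliques without edges between them, and equally large. -/
def IsCliquePair (G : SimpleGraph V) (X : Finset V) : Prop :=
  #X = #Xᶜ ∧ ∀ a b, G.Adj a b ↔ a ≠ b ∧ (a ∈ X ↔ b ∈ X)

/-- `σ` is a fixed-point free involution exchanging `X` and its complement. -/
def IsPairing (X : Finset V) (σ : V → V) : Prop :=
  (∀ a, σ (σ a) = a) ∧ ∀ a, σ a ∈ X ↔ a ∉ X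

omit [DecidableEq V] in
lemma neighborFinset_eq_of_subset_of_card_le {a : V} {S : Finset V}
    (h : G.neighborFinset a ⊆ S) (hc : #S ≤ G.degree a) : G.neighborFinset a = S :=
  Finset.eq_of_subset_of_card_le h (by rwa [card_neighborFinset_eq_degree])

/-- Vertices of `X` spend all their `n - 1` edges inside `X`. So the others have neighbours only
among the remaining `n - 1` vertices of the complement, and need all of them. -/
lemma isCliquePair_of_isClique {n : ℕ} (hV : Fintype.card V = 2 * n) {d : ℕ}
    (hd : ∀ v, G.degree v = d) (hdn : d + 1 = n) {X : Finset V} (hX : #X = n)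
    (hcl : ∀ a ∈ X, ∀ b ∈ X, a ≠ b → G.Adj a b) : G.IsCliquePair X := by
  have hXc : #Xᶜ = n := by rw [Finset.card_compl]; omega
  have h1 : ∀ a ∈ X, G.neighborFinset a = X.erase a := by
    intro a ha
    symm
    refine Finset.eq_of_subset_of_card_le ?_ ?_
    · intro b hb
      rw [Finset.mem_erase] at hb
      simpa using hcl a ha b hb.2 hb.1.symm
    · rw [card_neighborFinset_eq_degree, hd, Finset.card_erase_of_mem ha]
      omega
  have h2 : ∀ a ∉ X, G.neighborFinset a = Xᶜ.erase a := by
    intro a ha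
    refine neighborFinset_eq_of_subset_of_card_le ?_ ?_
    · intro b hb
      rw [mem_neighborFinset] at hb
      rw [Finset.mem_erase, Finset.mem_compl]
      refine ⟨hb.ne', fun hbX => ?_⟩
      have : a ∈ G.neighborFinset b := by simpa using hb.symm
      rw [h1 b hbX] at this
      exact ha (Finset.mem_of_mem_erase this)
    · rw [hd, Finset.card_erase_of_mem (by simpa)]
      omega
  refine ⟨by omega, fun a b => ?_⟩
  rw [← mem_neighborFinset]
  by_cases ha : a ∈ X
  · rw [h1 a ha]
    simp [ha, eq_comm]
  · rw [h2 a ha]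
    simp [ha, eq_comm]

lemma IsDegreeEquipartite.exists_isCliquePair_or (h : G.IsDegreeEquipartite) {n : ℕ}
    (hV : Fintype.card V = 2 * n) {d : ℕ} (hd : ∀ v, G.degree v = d) (hdn : d + 1 = n)
    (hn : 3 ≤ n) :
    (∃ X, G.IsCliquePair X) ∨ ∃ X σ, IsPairing X σ ∧
      ∀ a b, G.Adj a b ↔ (a ∈ X ↔ b ∉ X) ∧ b ≠ σ a := by
  have hdis := h.exists_disjoint hV hd hdn.le
  have hnz : (n : ℤ) = d + 1 := by exact_mod_cast hdn.symm
  by_cases ht : ∃ a b c, G.Adj a b ∧ G.Adj a c ∧ G.Adj b c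
  · left
    have htri : ∀ a b c, G.Adj a b → G.Adj a c → G.Adj b c → ∀ x, G.Adj a x → x ≠ b →
        G.Adj b x := by
      intro a b c hab hac hbc x hax hxb
      have key := h.triple_formula hn hV hd hab.ne hac.ne hbc.ne
      rw [cherryCount, adjInd_of_adj hab, adjInd_of_adj hac, adjInd_of_adj hbc, hnz] at key
      have i1 := codegree_add_one_le hab
      have i2 := codegree_add_one_le hac
      have i3 := codegree_add_one_le hbc
      refine adj_of_codegree_eq hab ?_ hax hxb
      rw [hd] at i1 i2 i3 ⊢
      -- For a triangle and `n = d + 1`, the triple formula makes the three codegrees sum to `3 * (d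
      -- - 1)`, while each is at most `d - 1`. Equality means adjacent triangle vertices share all
      -- other neighbours.
      have : (d : ℤ) * (G.codegree a b + G.codegree a c + G.codegree b c) =
          d * (3 * (d - 1)) := by
        linear_combination -key
      have := mul_left_cancel₀ (show (d : ℤ) ≠ 0 by omega) this
      lia
    obtain ⟨a, b, c, hab, hac, hbc⟩ := ht
    refine ⟨insert a (G.neighborFinset a), isCliquePair_of_isClique hV hd hdn ?_ ?_⟩
    · rw [Finset.card_insert_of_notMem (by simp), card_neighborFinset_eq_degree, hd, hdn]
    · have hb := htri a b c hab hac hbc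
      have hN : ∀ x y, G.Adj a x → G.Adj a y → x ≠ y → G.Adj x y := by
        intro x y hx hy hxy
        by_cases hxb : x = b
        · subst hxb
          exact hb y hy hxy.symm
        · exact htri a x b hx hab (hb x hx hxb).symm y hy hxy.symm
      intro x hx y hy hxy
      simp only [mem_insert, mem_neighborFinset] at hx hy
      rcases hx with rfl | hx <;> rcases hy with rfl | hy
      · exact absurd rfl hxy
      · exact hy
      · exact hx.symm
      · exact hN x y hx hy hxy
  · right
    push Not at ht
    have hne : Nonempty V := Fintype.card_pos_iff.1 (by omega)
    have v := hne.some
    obtain ⟨w, hvw, hnvw, hcom⟩ := hdis v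
    have hcover : ∀ v w, v ≠ w → ¬ G.Adj v w → (∀ z, G.Adj v z → ¬ G.Adj w z) →
        insert v (G.neighborFinset v) = (insert w (G.neighborFinset w))ᶜ := by
      intro v w hvw hnvw hcom
      refine Finset.eq_of_subset_of_card_le ?_ ?_
      · intro x hx
        simp only [mem_insert, mem_neighborFinset, mem_compl, not_or] at hx ⊢
        rcases hx with rfl | hx
        · exact ⟨hvw, fun e => hnvw e.symm⟩
        · exact ⟨fun e => hnvw (e ▸ hx), hcom x hx⟩
      · rw [Finset.card_compl, Finset.card_insert_of_notMem (by simp),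
          Finset.card_insert_of_notMem (by simp), card_neighborFinset_eq_degree,
          card_neighborFinset_eq_degree, hd, hd]
        omega
    have hcov : ∀ v w, v ≠ w → ¬ G.Adj v w → (∀ z, G.Adj v z → ¬ G.Adj w z) →
        ∀ z, z = v ∨ G.Adj v z ∨ z = w ∨ G.Adj w z := by
      intro v w h1 h2 h3 z
      have := hcover v w h1 h2 h3
      have := Finset.ext_iff.1 this z
      simp only [mem_insert, mem_neighborFinset, mem_compl, not_or] at this
      tauto
    -- The two closed neighbourhoods partition the vertices. In the triangle-free case the open
    -- neighbourhoods are independent, so moving `w` over to the neighbours of `v` gives a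
    -- bipartition.
    set X : Finset V := insert w (G.neighborFinset v) with hX
    have hXm : ∀ z, z ∈ X ↔ z = w ∨ G.Adj v z := by simp [hX]
    have hXm' : ∀ z, z ∉ X ↔ z = v ∨ G.Adj w z := by
      intro z
      rw [hXm]
      have c1 := hcov v w hvw hnvw hcom z
      have c2 := hcom z
      constructor
      · tauto
      · rintro (rfl | hz) (rfl | hz')
        · exact hvw rfl
        · exact G.loopless.irrefl _ hz'
        · exact G.loopless.irrefl _ hz
        · exact c2 hz' hz
    have hbip : ∀ a b, G.Adj a b → (a ∈ X ↔ b ∉ X) := by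
      intro a b hab
      by_cases ha : a ∈ X
      · refine iff_of_true ha fun hb => ?_
        rw [hXm] at ha hb
        rcases ha with rfl | ha <;> rcases hb with rfl | hb
        · exact G.loopless.irrefl _ hab
        · exact hcom b hb hab
        · exact hcom a ha hab.symm
        · exact ht v a b ha hb hab
      · refine iff_of_false ha fun hb => ?_
        rw [hXm'] at ha hb
        rcases ha with rfl | ha <;> rcases hb with rfl | hb
        · exact G.loopless.irrefl _ hab
        · exact hcom b hab hb
        · exact hcom a hab.symm ha
        · exact ht w a b ha hb hab
    have hcX : #X = n := by
      rw [hX, Finset.card_insert_of_notMem (by simpa using hnvw), card_neighborFinset_eq_degree,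
        hd, hdn]
    have hcX' : #Xᶜ = n := by rw [Finset.card_compl]; omega
    choose σ hσ1 hσ2 hσ3 using hdis
    have hflip : ∀ a, σ a ∈ X ↔ a ∉ X := by
      intro a
      -- If `a` and `σ a` were on the same side, their disjoint neighbourhoods would fill `2 * d`
      -- places in a side of size `d + 1`, impossible for `d ≥ 2`.
      have hsmall : ∀ S : Finset V, #S = n → G.neighborFinset a ⊆ S →
          G.neighborFinset (σ a) ⊆ S → False := by
        intro S hS s1 s2
        have := Finset.card_le_card (Finset.union_subset s1 s2)
        rw [Finset.card_union_of_disjoint, card_neighborFinset_eq_degree,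
          card_neighborFinset_eq_degree, hd, hd] at this
        · omega
        · refine Finset.disjoint_left.2 fun z hz hz' => ?_
          exact hσ3 a z (by simpa using hz) (by simpa using hz')
      by_contra hcon
      by_cases ha : a ∈ X
      · refine hsmall Xᶜ hcX' ?_ ?_ <;> intro z hz <;> rw [mem_neighborFinset] at hz <;>
          have := hbip _ _ hz <;> simp only [mem_compl] <;> tauto
      · refine hsmall X hcX ?_ ?_ <;> intro z hz <;> rw [mem_neighborFinset] at hz <;>
          have := hbip _ _ hz <;> tauto
    have hadj : ∀ a b, G.Adj a b ↔ (a ∈ X ↔ b ∉ X) ∧ b ≠ σ a := by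
      intro a b
      constructor
      · intro hab
        exact ⟨hbip a b hab, fun e => hσ2 a (e ▸ hab)⟩
      · rintro ⟨h1, h2⟩
        rcases hcov a (σ a) (hσ1 a) (hσ2 a) (hσ3 a) b with rfl | hb | rfl | hb
        · tauto
        · exact hb
        · exact absurd rfl h2
        · have := hbip _ _ hb
          have := hflip a
          tauto
    refine ⟨X, σ, ⟨fun a => ?_, hflip⟩, hadj⟩
    by_contra hne
    refine hσ2 a ((hadj (σ a) a).2 ⟨?_, fun e => hne e.symm⟩).symm
    exact hflip a

lemma IsDegreeEquipartite.degree_eq_two (h : G.IsDegreeEquipartite) {n : ℕ}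
    (hV : Fintype.card V = 2 * n) {d : ℕ} (hd : ∀ v, G.degree v = d) (hdn : d + 1 < n)
    (h2 : 2 ≤ d) :
    n = 4 ∧ d = 2 ∧ ∀ a b c, G.Adj a b → G.Adj b c → G.neighborFinset a = G.neighborFinset c := by
  have hn : 3 ≤ n := by omega
  have hne : Nonempty V := Fintype.card_pos_iff.1 (by omega)
  have v := hne.some
  obtain ⟨w, hvw, hnvw, hcom⟩ := h.exists_disjoint hV hd hdn.le v
  -- Triple formula for `v`, a neighbour `u` of `v`, and `w`: it spans one edge and no cherry.
  have hlow : 2 * (n - 1 : ℤ) ≤ 3 * d := by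
    obtain ⟨u, hu⟩ : (G.neighborFinset v).Nonempty := by
      rw [← Finset.card_pos, card_neighborFinset_eq_degree, hd]
      omega
    rw [mem_neighborFinset] at hu
    have huw : u ≠ w := fun e => hnvw (e ▸ hu)
    have key := h.triple_formula hn hV hd hu.ne hvw huw
    rw [cherryCount, adjInd_of_adj hu, adjInd_of_not_adj hnvw,
      adjInd_of_not_adj (fun e => hcom u hu e.symm), codegree_eq_zero_of_forall hcom] at key
    have := codegree_nonneg (G := G) v u
    have := codegree_nonneg (G := G) u w
    have hd1 : (0 : ℤ) < d - 1 := by lia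
    refine le_of_mul_le_mul_right ?_ hd1
    have : 0 ≤ ((n : ℤ) - 1) * (G.codegree v u + G.codegree u w) :=
      mul_nonneg (by lia) (by lia)
    linarith
  -- Triple formula for an independent triple `v`, `w`, `z`, with `z` outside both closed
  -- neighbourhoods. The neighbours that `z` shares with `v` and with `w` are disjoint subsets of
  -- its `d` neighbours.
  have hup : 3 * (d - 1 : ℤ) ≤ n - 1 := by
    obtain ⟨z, hz⟩ : ((insert v (G.neighborFinset v)) ∪ (insert w (G.neighborFinset w)))ᶜ.Nonempty := by
      rw [← Finset.card_pos, Finset.card_compl]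
      have := Finset.card_union_le (insert v (G.neighborFinset v)) (insert w (G.neighborFinset w))
      rw [Finset.card_insert_of_notMem (by simp), Finset.card_insert_of_notMem (by simp),
        card_neighborFinset_eq_degree, card_neighborFinset_eq_degree, hd, hd] at this
      omega
    simp only [mem_compl, mem_union, mem_insert, mem_neighborFinset, not_or] at hz
    obtain ⟨⟨hzv, hnvz⟩, hzw, hnwz⟩ := hz
    have key := h.triple_formula hn hV hd hvw (Ne.symm hzv) (Ne.symm hzw)
    rw [cherryCount, adjInd_of_not_adj hnvw, adjInd_of_not_adj hnvz, adjInd_of_not_adj hnwz,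
      codegree_eq_zero_of_forall hcom] at key
    have hle : G.codegree v z + G.codegree w z ≤ d := by
      rw [← hd z, ← card_neighborFinset_eq_degree, codegree, codegree, ← Nat.cast_add,
        ← Finset.card_union_of_disjoint]
      · exact_mod_cast Finset.card_le_card
          (Finset.union_subset Finset.inter_subset_right Finset.inter_subset_right)
      · refine Finset.disjoint_left.2 fun x hx hx' => ?_
        simp only [mem_inter, mem_neighborFinset] at hx hx'
        exact hcom x hx.1 hx'.1
    have hd0 : (0 : ℤ) < d := by lia
    refine le_of_mul_le_mul_right ?_ hd0
    have : ((n : ℤ) - 1) * (G.codegree v z + G.codegree w z) ≤ (n - 1) * d :=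
      mul_le_mul_of_nonneg_left hle (by lia)
    linarith
  obtain rfl : d = 2 := by lia
  obtain rfl : n = 4 := by lia
  have hnt : ∀ a b c, G.Adj a b → G.Adj a c → ¬ G.Adj b c := by
    intro a b c hab hac hbc
    have key := h.triple_formula hn hV hd hab.ne hac.ne hbc.ne
    rw [cherryCount, adjInd_of_adj hab, adjInd_of_adj hac, adjInd_of_adj hbc] at key
    have i1 := codegree_add_one_le hab
    have i2 := codegree_add_one_le hac
    have i3 := codegree_add_one_le hbc
    rw [hd] at i1 i2 i3
    push_cast at *
    lia
  refine ⟨rfl, rfl, fun a b c hab hbc => ?_⟩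
  by_cases hac : a = c
  · rw [hac]
  have hnac : ¬ G.Adj a c := fun e => hnt a b c hab e hbc
  have key := h.triple_formula hn hV hd hab.ne hac hbc.ne
  rw [cherryCount, adjInd_of_adj hab, adjInd_of_adj hbc, adjInd_of_not_adj hnac,
    codegree_eq_zero_of_forall (fun z => hnt a b z hab),
    codegree_eq_zero_of_forall (a := b) (b := c) (fun z => hnt b c z hbc)] at key
  -- For an induced path with `n = 4`, `d = 2`, the formula makes the codegree of the ends equal to
  -- the degree.
  have hcd : #(G.neighborFinset a ∩ G.neighborFinset c) = 2 := by
    unfold codegree at key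
    push_cast at key
    lia
  have e1 := Finset.eq_of_subset_of_card_le
    (Finset.inter_subset_left (s₁ := G.neighborFinset a) (s₂ := G.neighborFinset c))
    (by rw [hcd, card_neighborFinset_eq_degree, hd])
  have e2 := Finset.eq_of_subset_of_card_le
    (Finset.inter_subset_right (s₁ := G.neighborFinset a) (s₂ := G.neighborFinset c))
    (by rw [hcd, card_neighborFinset_eq_degree, hd])
  exact e1.symm.trans e2

end Structure

/-! ### Automorphisms exchanging the parts, for each surviving graph. -/

section Automorphisms

lemma exists_perm_comp_eq {ι κ : Type*} [Fintype ι] [DecidableEq κ] (c c' : ι → κ)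
    (h : ∀ k, #{i | c i = k} = #{i | c' i = k}) : ∃ g : Equiv.Perm ι, ∀ i, c' (g i) = c i := by
  have e : ∀ k, Nonempty ({i // c i = k} ≃ {i // c' i = k}) := fun k => by
    rw [← Fintype.card_eq, Fintype.card_subtype, Fintype.card_subtype]
    exact h k
  exact ⟨Equiv.ofFiberEquiv fun k => (e k).some, fun i => Equiv.ofFiberEquiv_map _ i⟩

variable {V : Type*} [Fintype V] [DecidableEq V] {G : SimpleGraph V}

lemma isEquipartite_iff : G.IsEquipartite ↔ ∀ A : Finset V, IsBisection A →
    ∃ f : Equiv.Perm V, (∀ a b, G.Adj (f a) (f b) ↔ G.Adj a b) ∧ ∀ a, f a ∈ A ↔ a ∉ A := by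
  refine forall₂_congr fun A _ => ⟨?_, ?_⟩
  · rintro ⟨f, hf⟩
    refine ⟨f.toEquiv, fun a b => f.map_adj_iff, fun a => ?_⟩
    have h1 := Set.ext_iff.1 hf (f a)
    simp only [Set.mem_image, Set.mem_ofPred_eq, EmbeddingLike.apply_eq_iff_eq, exists_eq_right,
      mem_compl] at h1
    change f a ∈ A ↔ _
    tauto
  · rintro ⟨f, hf, hA⟩
    refine ⟨⟨f, fun {a b} => hf a b⟩, ?_⟩
    ext x
    simp only [Set.mem_image, Set.mem_ofPred_eq, mem_compl]
    constructor
    · rintro ⟨a, ha, rfl⟩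
      change f a ∉ A
      rw [hA]
      simpa using ha
    · intro hx
      refine ⟨f.symm x, ?_, f.apply_symm_apply x⟩
      have := hA (f.symm x)
      rw [f.apply_symm_apply] at this
      tauto

lemma IsEquipartite.of_compl (h : Gᶜ.IsEquipartite) : G.IsEquipartite := by
  rw [isEquipartite_iff] at h ⊢
  intro A hA
  obtain ⟨f, hf, hfA⟩ := h A hA
  refine ⟨f, fun a b => ?_, hfA⟩
  have := hf a b
  simp only [compl_adj, ne_eq, EmbeddingLike.apply_eq_iff_eq] at this
  by_cases hab : a = b
  · subst hab
    simp
  · tauto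

lemma isEquipartite_of_forall_not_adj (h : ∀ a b, ¬ G.Adj a b) : G.IsEquipartite := by
  rw [isEquipartite_iff]
  intro A hA
  obtain ⟨g, hg⟩ := exists_perm_comp_eq (fun v => decide (v ∉ A)) (fun v => decide (v ∈ A)) (by
    rw [IsBisection] at hA
    have e1 : univ.filter (· ∈ A) = A := by ext; simp
    have e2 : univ.filter (· ∉ A) = Aᶜ := by ext; simp
    rintro (_ | _) <;>
      simp only [decide_eq_true_eq, decide_eq_false_iff_not, not_not, e1, e2, hA])
  exact ⟨g, by simp [h], fun a => decide_eq_decide.1 (hg a)⟩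

/-- Since `A` and `X` both have half the vertices, opposite cells of the 2 × 2 partition they
generate are equally large, so some permutation exchanges opposite cells. -/
lemma IsCliquePair.isEquipartite {X : Finset V} (h : G.IsCliquePair X) : G.IsEquipartite := by
  rw [isEquipartite_iff]
  intro A hA
  obtain ⟨hX, hadj⟩ := h
  obtain ⟨g, hg⟩ := exists_perm_comp_eq (fun v => (decide (v ∉ A), decide (v ∉ X)))
    (fun v => (decide (v ∈ A), decide (v ∈ X))) (by
    have e1 : #(X ∩ A) = #(Xᶜ ∩ Aᶜ) := by
      have h1 := Finset.card_inter_add_card_sdiff A X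
      have h2 := Finset.card_inter_add_card_sdiff Xᶜ A
      have h3 : Xᶜ ∩ A = A \ X := by ext; simp [and_comm]
      have h4 : Xᶜ \ A = Xᶜ ∩ Aᶜ := by ext; simp
      have := Finset.card_add_card_compl A
      have := Finset.card_add_card_compl X
      rw [IsBisection] at hA
      rw [Finset.inter_comm X A]
      rw [h3, h4] at h2
      omega
    have e2 : #(X ∩ Aᶜ) = #(Xᶜ ∩ A) := by
      have h1 := Finset.card_inter_add_card_sdiff A X
      have h2 := Finset.card_inter_add_card_sdiff X A
      have h3 : Xᶜ ∩ A = A \ X := by ext; simp [and_comm]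
      have h4 : X \ A = X ∩ Aᶜ := by ext; simp
      have := Finset.card_add_card_compl A
      have := Finset.card_add_card_compl X
      rw [IsBisection] at hA
      rw [Finset.inter_comm X A, h4] at h2
      rw [h3]
      omega
    have f1 : ∀ p : V → Prop, ∀ [DecidablePred p], ∀ S : Finset V, (∀ v, p v ↔ v ∈ S) →
        univ.filter p = S := by
      intro p _ S hp
      ext v
      simp [hp]
    rintro ⟨_ | _, _ | _⟩
    · rw [f1 _ (X ∩ A) (by simp [and_comm]), f1 _ (Xᶜ ∩ Aᶜ) (by simp [and_comm]), e1]
    · rw [f1 _ (Xᶜ ∩ A) (by simp [and_comm]), f1 _ (X ∩ Aᶜ) (by simp [and_comm]), e2]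
    · rw [f1 _ (X ∩ Aᶜ) (by simp [and_comm]), f1 _ (Xᶜ ∩ A) (by simp [and_comm]), e2]
    · rw [f1 _ (Xᶜ ∩ Aᶜ) (by simp [and_comm]), f1 _ (X ∩ A) (by simp [and_comm]), e1])
  simp only [Prod.mk.injEq, decide_eq_decide] at hg
  refine ⟨g, fun a b => ?_, fun a => (hg a).1⟩
  rw [hadj, hadj, (hg a).2, (hg b).2]
  simp only [ne_eq, EmbeddingLike.apply_eq_iff_eq]
  tauto

/-- Because `A` is a bisection, as many pairs `{x, σ x}` lie inside `A` as outside it. Exchange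
these two kinds, and reverse the pairs that meet both parts. -/
lemma IsPairing.exists_perm {X : Finset V} {σ : V → V} (h : IsPairing X σ) {A : Finset V}
    (hA : IsBisection A) : ∃ f : Equiv.Perm V, (∀ a, f (σ a) = σ (f a)) ∧
      (∀ a, f a ∈ X ↔ a ∉ X) ∧ ∀ a, f a ∈ A ↔ a ∉ A := by
  obtain ⟨hσ, hX⟩ := h
  have hsplit : ∀ B : Finset V, #{x : X | x.1 ∈ B ∧ σ x ∈ B} + #{x : X | x.1 ∈ B ∧ σ x ∉ B}
      + (#{x : X | x.1 ∈ B ∧ σ x ∈ B} + #{x : X | x.1 ∉ B ∧ σ x ∈ B}) = #B := by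
    intro B
    have h1 : #{x : X | x.1 ∈ B} = #(B ∩ X) := by
      refine Finset.card_bij (fun x _ => x.1) ?_ ?_ ?_
      · intro x hx; simpa using hx
      · intro x _ y _ e; exact Subtype.ext e
      · intro b hb
        rw [mem_inter] at hb
        exact ⟨⟨b, hb.2⟩, by simpa using hb.1, rfl⟩
    have h2 : #{x : X | σ x ∈ B} = #(B \ X) := by
      refine Finset.card_bij (fun x _ => σ x.1) ?_ ?_ ?_
      · intro x hx
        simp only [mem_filter, mem_univ, true_and] at hx
        simp [hx, hX]
      · intro x _ y _ e
        refine Subtype.ext ?_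
        rw [← hσ x, e, hσ]
      · intro b hb
        rw [mem_sdiff] at hb
        exact ⟨⟨σ b, (hX b).2 hb.2⟩, by simpa [hσ] using hb.1, hσ b⟩
    rw [← Finset.card_inter_add_card_sdiff B X, ← h1, ← h2]
    congr 1
    · rw [← Finset.card_filter_add_card_filter_not (s := {x : X | x.1 ∈ B}) (fun x => σ x ∈ B)]
      simp only [Finset.filter_filter]
    · rw [← Finset.card_filter_add_card_filter_not (s := {x : X | σ x ∈ B}) (fun x => x.1 ∈ B)]
      simp only [Finset.filter_filter, and_comm]
  -- The target colours are listed in reverse order because `x` will be sent to `σ (g x)` and `σ x`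
  -- to `g x`.
  obtain ⟨g, hg⟩ := exists_perm_comp_eq (ι := X)
    (fun x => (decide (x.1 ∉ A), decide (σ x ∉ A))) (fun x => (decide (σ x ∈ A), decide (x.1 ∈ A)))
    (by
      have s1 := hsplit A
      have s2 := hsplit Aᶜ
      rw [IsBisection] at hA
      simp only [mem_compl, not_not] at s2
      rintro ⟨_ | _, _ | _⟩ <;> simp only [Prod.mk.injEq, decide_eq_true_eq, decide_eq_false_iff_not, not_not] <;>
        simp only [and_comm] at s1 s2 ⊢ <;> omega)
  simp only [Prod.mk.injEq, decide_eq_decide] at hg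
  let f : V → V := fun a => if ha : a ∈ X then σ (g ⟨a, ha⟩) else g ⟨σ a, (hX a).2 ha⟩
  have fX : ∀ a (ha : a ∈ X), f a = σ (g ⟨a, ha⟩) := fun a ha => dif_pos ha
  have fX' : ∀ a (ha : a ∉ X), f a = g ⟨σ a, (hX a).2 ha⟩ := fun a ha => dif_neg ha
  have fσ : ∀ a, f (σ a) = σ (f a) := by
    intro a
    by_cases ha : a ∈ X
    · rw [fX a ha, fX' (σ a) (by rw [hX]; simpa)]
      simp only [hσ]
    · rw [fX' a ha, fX (σ a) ((hX a).2 ha)]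
  have fm : ∀ a, f a ∈ X ↔ a ∉ X := by
    intro a
    by_cases ha : a ∈ X
    · rw [fX a ha, hX]
      simp [ha]
    · rw [fX' a ha]
      simp [ha]
  have finj : Function.Injective f := by
    have aux : ∀ a b, a ∈ X → b ∈ X → f a = f b → a = b := by
      intro a b ha hb e
      rw [fX a ha, fX b hb] at e
      have := congrArg σ e
      rw [hσ, hσ] at this
      simpa using g.injective (Subtype.ext this)
    intro a b e
    by_cases ha : a ∈ X
    · have hb : b ∈ X := by
        by_contra hb
        have := (fm b).2 hb
        rw [← e, fm] at this
        exact this ha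
      exact aux a b ha hb e
    · have hb : b ∉ X := by
        have := (fm a).2 ha
        rwa [e, fm] at this
      have := aux (σ a) (σ b) ((hX a).2 ha) ((hX b).2 hb) (by rw [fσ, fσ, e])
      rw [← hσ a, this, hσ]
  refine ⟨Equiv.ofBijective f (Finite.injective_iff_bijective.1 finj), fσ, fm, fun a => ?_⟩
  change f a ∈ A ↔ _
  by_cases ha : a ∈ X
  · rw [fX a ha]
    exact (hg ⟨a, ha⟩).1
  · rw [fX' a ha]
    have := (hg ⟨σ a, (hX a).2 ha⟩).2
    simpa only [hσ] using this

lemma IsPairing.isEquipartite_of_adj_iff_and_ne {X : Finset V} {σ : V → V} (h : IsPairing X σ)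
    (hadj : ∀ a b, G.Adj a b ↔ (a ∈ X ↔ b ∉ X) ∧ b ≠ σ a) : G.IsEquipartite := by
  rw [isEquipartite_iff]
  intro A hA
  obtain ⟨f, h1, h2, h3⟩ := h.exists_perm hA
  refine ⟨f, fun a b => ?_, h3⟩
  rw [hadj, hadj, h2, h2, ← h1, ne_eq, ne_eq, f.apply_eq_iff_eq]
  tauto

lemma IsPairing.isEquipartite_of_adj_iff_eq {X : Finset V} {σ : V → V} (h : IsPairing X σ)
    (hadj : ∀ a b, G.Adj a b ↔ b = σ a) : G.IsEquipartite := by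
  rw [isEquipartite_iff]
  intro A hA
  obtain ⟨f, h1, h2, h3⟩ := h.exists_perm hA
  refine ⟨f, fun a b => ?_, h3⟩
  rw [hadj, hadj, ← h1, f.apply_eq_iff_eq]

lemma isEquipartite_of_degree_eq_one [DecidableRel G.Adj] (hd : ∀ v, G.degree v = 1) :
    G.IsEquipartite := by
  have h1 : ∀ v, ∃ w, G.neighborFinset v = {w} := fun v => by
    rw [← Finset.card_eq_one, card_neighborFinset_eq_degree, hd]
  choose σ hσ using h1
  have hadj : ∀ a b, G.Adj a b ↔ b = σ a := fun a b => by
    rw [← mem_neighborFinset, hσ, mem_singleton]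
  have hσσ : ∀ a, σ (σ a) = a := fun a => by
    have := (hadj a (σ a)).2 rfl
    exact ((hadj _ _).1 this.symm).symm
  let e := Fintype.equivFin V
  -- Any linear order chooses one end of each edge.
  refine IsPairing.isEquipartite_of_adj_iff_eq (X := {a | e a < e (σ a)}) ⟨hσσ, fun a => ?_⟩ hadj
  have hne : e a ≠ e (σ a) := fun E => ((hadj a (σ a)).2 rfl).ne (e.injective E)
  simp only [mem_filter, mem_univ, true_and, hσσ]
  lia

/-- The automorphism group of the complete binary tree of depth three acts transitively enough on
the leaves to exchange the two parts of every bisection of the leaves. -/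
lemma exists_tree_automorphism (a : Bool × Bool × Bool → Bool)
    (h : ∑ x, (a x).toNat = 4) : ∃ (r : Bool) (s : Bool → Bool) (t : Bool → Bool → Bool),
      ∀ i j k, a (i ^^ r, j ^^ s i, k ^^ t i j) = !a (i, j, k) := by
  -- If the halves carry `k ≠ 2` and `4 - k` marks, exchange them: such a marking of a half is
  -- determined by its count up to automorphism. If both carry two, each half is already equivalent
  -- to its own complement. The kernel checks all cases.
  have key : ∀ a0 a1 a2 a3 a4 a5 a6 a7 : Bool, a0.toNat + a1.toNat + (a2.toNat + a3.toNat) +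
      (a4.toNat + a5.toNat + (a6.toNat + a7.toNat)) = 4 →
      ∃ r s0 s1 t0 t1 t2 t3 : Bool,
        let b := fun i j k : Bool => bif i then (bif j then (bif k then a0 else a1)
          else (bif k then a2 else a3)) else (bif j then (bif k then a4 else a5)
          else (bif k then a6 else a7))
        ∀ i j k : Bool, b (i ^^ r) (j ^^ (bif i then s0 else s1))
          (k ^^ (bif i then (bif j then t0 else t1) else (bif j then t2 else t3))) = !b i j k := by
    decide +kernel
  simp only [Fintype.sum_prod_type, Fintype.sum_bool] at h
  obtain ⟨r, s0, s1, t0, t1, t2, t3, hb⟩ := key _ _ _ _ _ _ _ _ h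
  refine ⟨r, fun i => bif i then s0 else s1,
    fun i j => bif i then (bif j then t0 else t1) else (bif j then t2 else t3), fun i j k => ?_⟩
  have hb' : ∀ i j k, (bif i then (bif j then (bif k then a (true, true, true)
      else a (true, true, false)) else (bif k then a (true, false, true)
      else a (true, false, false))) else (bif j then (bif k then a (false, true, true)
      else a (false, true, false)) else (bif k then a (false, false, true)
      else a (false, false, false)))) = a (i, j, k) := by
    rintro (_ | _) (_ | _) (_ | _) <;> rfl
  have := hb i j k
  simp only [hb'] at this
  exact this

/-- The two neighbours of `v` have the same two neighbours, `v` and some `u`, which closes a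
4-cycle. The first bit of the coordinate is the side of its bipartition. -/
lemma exists_four_cycle [DecidableRel G.Adj] (hd : ∀ v, G.degree v = 2)
    (hG : ∀ a b c, G.Adj a b → G.Adj b c → G.neighborFinset a = G.neighborFinset c) (v : V) :
    ∃ q : Bool × Bool → V, Function.Injective q ∧ q (false, false) = v ∧
      ∀ j k x, G.Adj (q (j, k)) x ↔ ∃ k', q (!j, k') = x := by
  have h2 : ∀ v, ∃ x y, x ≠ y ∧ G.neighborFinset v = {x, y} := fun v => by
    rw [← Finset.card_eq_two, card_neighborFinset_eq_degree, hd]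
  obtain ⟨p, p', hp, hv⟩ := h2 v
  have hvp : G.Adj v p := by rw [← mem_neighborFinset, hv]; simp
  have hvp' : G.Adj v p' := by rw [← mem_neighborFinset, hv]; simp
  obtain ⟨u, hu, hNp⟩ : ∃ u, v ≠ u ∧ G.neighborFinset p = {v, u} := by
    obtain ⟨x, y, hxy, hN⟩ := h2 p
    have : v ∈ G.neighborFinset p := by simpa using hvp.symm
    rw [hN] at this
    simp only [mem_insert, mem_singleton] at this
    rcases this with rfl | rfl
    · exact ⟨y, hxy, hN⟩
    · exact ⟨x, hxy.symm, by rw [hN, Finset.pair_comm]⟩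
  have hpu : G.Adj p u := by rw [← mem_neighborFinset, hNp]; simp
  have hNp' : G.neighborFinset p' = {v, u} := by rw [← hNp, hG p v p' hvp.symm hvp']
  have hNu : G.neighborFinset u = {p, p'} := by rw [← hv, hG v p u hvp hpu]
  have hup' : G.Adj u p' := by rw [← mem_neighborFinset, hNu]; simp
  refine ⟨fun x => bif x.1 then (bif x.2 then p' else p) else (bif x.2 then u else v), ?_, rfl, ?_⟩
  · have := hvp.ne
    have := hvp'.ne
    have := hpu.ne
    have := hup'.ne
    rintro ⟨_ | _, _ | _⟩ ⟨_ | _, _ | _⟩ <;> simp_all [eq_comm]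
  · rintro (_ | _) (_ | _) x <;> rw [← mem_neighborFinset] <;> simp [*, eq_comm]

/-- Two 4-cycles form the leaves of a binary tree with levels cycle, side, vertex. Adjacency means
same cycle and different side, which every tree automorphism preserves. -/
lemma isEquipartite_of_degree_eq_two [DecidableRel G.Adj] (hV : Fintype.card V = 8)
    (hd : ∀ v, G.degree v = 2)
    (hG : ∀ a b c, G.Adj a b → G.Adj b c → G.neighborFinset a = G.neighborFinset c) :
    G.IsEquipartite := by
  have hne : Nonempty V := Fintype.card_pos_iff.1 (by omega)
  obtain ⟨q, hq, -, hqN⟩ := exists_four_cycle hd hG hne.some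
  obtain ⟨v, hv⟩ : ∃ v, ∀ x, q x ≠ v := by
    by_contra! hcon
    have := Fintype.card_le_of_surjective q hcon
    simp [hV] at this
  obtain ⟨q', hq', hv', hqN'⟩ := exists_four_cycle hd hG v
  have hcl : ∀ x y, G.Adj (q x) y → ∃ z, q z = y := by
    rintro ⟨j, k⟩ y hy
    obtain ⟨k', hk'⟩ := (hqN j k y).1 hy
    exact ⟨_, hk'⟩
  have hdisj : ∀ x y, q x ≠ q' y := by
    intro x y e
    -- The first cycle is closed under adjacency, so a common vertex could be walked along the
    -- second cycle to `v`, which was chosen off the first.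
    have hstep : ∀ j k k', (∃ z, q z = q' (j, k)) → ∃ z, q z = q' (!j, k') := by
      rintro j k k' ⟨z, hz⟩
      refine hcl z _ ?_
      rw [hz, hqN']
      exact ⟨k', rfl⟩
    have h0 : ∃ z, q z = q' (false, false) := by
      obtain ⟨j, k⟩ := y
      cases j
      · exact hstep true false false (hstep false k false ⟨x, e⟩)
      · exact hstep true k false ⟨x, e⟩
    obtain ⟨z, hz⟩ := h0
    exact hv z (hz.trans hv')
  let e : Bool × Bool × Bool → V := fun x => bif x.1 then q x.2 else q' x.2
  have he : Function.Injective e := by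
    rintro ⟨_ | _, x⟩ ⟨_ | _, y⟩ hxy
    · simpa using hq' hxy
    · exact absurd hxy.symm (hdisj _ _)
    · exact absurd hxy (hdisj _ _)
    · simpa using hq hxy
  let E : Bool × Bool × Bool ≃ V := Equiv.ofBijective e
    ((Fintype.bijective_iff_injective_and_card e).2 ⟨he, by simp [hV]⟩)
  have hadj : ∀ i j k i' j' k', G.Adj (E (i, j, k)) (E (i', j', k')) ↔ i = i' ∧ j ≠ j' := by
    have h1 : ∀ i j k x, G.Adj (E (i, j, k)) x ↔ ∃ l, E (i, !j, l) = x := by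
      rintro (_ | _) j k x
      · exact hqN' j k x
      · exact hqN j k x
    intro i j k i' j' k'
    rw [h1]
    simp only [EmbeddingLike.apply_eq_iff_eq, Prod.mk.injEq]
    cases i <;> cases i' <;> cases j <;> cases j' <;> simp
  rw [isEquipartite_iff]
  intro A hA
  obtain ⟨r, s, t, hrst⟩ := exists_tree_automorphism (fun x => decide (E x ∈ A)) (by
    have h1 : ∑ x, (decide (E x ∈ A)).toNat = ∑ v, (decide (v ∈ A)).toNat :=
      E.sum_comp fun v => (decide (v ∈ A)).toNat
    have h2 : ∑ v, (decide (v ∈ A)).toNat = #A := by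
      simp [Bool.toNat, Bool.cond_decide]
    rw [h1, h2]
    rw [IsBisection, Finset.card_compl] at hA
    omega)
  let τ : Bool × Bool × Bool → Bool × Bool × Bool :=
    fun x => (x.1 ^^ r, x.2.1 ^^ s x.1, x.2.2 ^^ t x.1 x.2.1)
  have hτ : Function.Injective τ := by
    rintro ⟨i, j, k⟩ ⟨i', j', k'⟩ h
    simp only [τ, Prod.mk.injEq, Bool.xor_left_inj] at h
    obtain ⟨rfl, h⟩ := h
    simp only [Bool.xor_left_inj] at h
    obtain ⟨rfl, h⟩ := h
    simp only [Bool.xor_left_inj] at h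
    rw [h]
  let T : Equiv.Perm (Bool × Bool × Bool) :=
    Equiv.ofBijective τ (Finite.injective_iff_bijective.1 hτ)
  refine ⟨(E.symm.trans T).trans E, ?_, ?_⟩
  · intro a b
    obtain ⟨⟨i, j, k⟩, rfl⟩ := E.surjective a
    obtain ⟨⟨i', j', k'⟩, rfl⟩ := E.surjective b
    simp only [Equiv.trans_apply, Equiv.symm_apply_apply]
    change G.Adj (E (_, _, _)) (E (_, _, _)) ↔ _
    rw [hadj, hadj]
    simp only [Bool.xor_left_inj]
    refine and_congr_right ?_
    rintro rfl
    simp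
  · intro a
    obtain ⟨⟨i, j, k⟩, rfl⟩ := E.surjective a
    simp only [Equiv.trans_apply, Equiv.symm_apply_apply]
    have := hrst i j k
    rw [Bool.eq_not, ne_eq, decide_eq_decide] at this
    change E (_, _, _) ∈ A ↔ _
    tauto

end Automorphisms

/-! ### Complementation and assembly. -/

section Main

variable {V : Type*} [Fintype V] [DecidableEq V] {G : SimpleGraph V} [DecidableRel G.Adj]

lemma degreeIn_compl {A : Finset V} {v : V} (hv : v ∈ A) :
    Gᶜ.degreeIn A v = #A - 1 - G.degreeIn A v := by
  have : Gᶜ.neighborFinset v ∩ A = (A.erase v) \ (G.neighborFinset v ∩ A) := by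
    ext x
    simp only [mem_inter, mem_neighborFinset, compl_adj, mem_sdiff, mem_erase]
    tauto
  rw [degreeIn, this, Finset.card_sdiff_of_subset, Finset.card_erase_of_mem hv, degreeIn]
  intro x hx
  simp only [mem_inter, mem_neighborFinset, mem_erase] at hx ⊢
  exact ⟨hx.1.ne', hx.2⟩

lemma IsDegreeEquipartite.compl (h : G.IsDegreeEquipartite) : Gᶜ.IsDegreeEquipartite := by
  rw [isDegreeEquipartite_iff] at h ⊢
  intro A hA
  -- Complementing turns a degree `k` inside a part into `#A - 1 - k`, by the same rule in both
  -- parts since they are equally large.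
  have h1 := congrArg (Multiset.map fun k => #A - 1 - k) (h A hA)
  rw [Multiset.map_map, Multiset.map_map] at h1
  rw [Multiset.map_congr rfl fun v hv => degreeIn_compl (G := G) (A := A) (by simpa using hv),
    Multiset.map_congr (s := Aᶜ.val) rfl
      fun v hv => degreeIn_compl (G := G) (A := Aᶜ) (by simpa using hv)]
  rw [IsBisection] at hA
  rw [← hA]
  exact h1

lemma IsDegreeEquipartite.isEquipartite_of_degree_lt (h : G.IsDegreeEquipartite) {n : ℕ}
    (hV : Fintype.card V = 2 * n) {d : ℕ} (hd : ∀ v, G.degree v = d) (hdn : d < n) :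
    G.IsEquipartite := by
  by_cases h0 : d = 0
  · subst h0
    refine isEquipartite_of_forall_not_adj fun a b hab => ?_
    have := hd a
    rw [← card_neighborFinset_eq_degree, card_eq_zero] at this
    have hb : b ∈ G.neighborFinset a := by simpa using hab
    simp [this] at hb
  by_cases h1 : d = 1
  · subst h1
    exact isEquipartite_of_degree_eq_one hd
  by_cases h2 : d + 1 = n
  · rcases h.exists_isCliquePair_or hV hd h2 (by omega) with ⟨X, hX⟩ | ⟨X, σ, hX, hadj⟩
    · exact hX.isEquipartite
    · exact hX.isEquipartite_of_adj_iff_and_ne hadj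
  · obtain ⟨rfl, rfl, hG⟩ := h.degree_eq_two hV hd (by omega) (by omega)
    exact isEquipartite_of_degree_eq_two hV hd hG

lemma IsDegreeEquipartite.isEquipartite (h : G.IsDegreeEquipartite)
    (hV : Even (Fintype.card V)) : G.IsEquipartite := by
  obtain ⟨n, hn⟩ := even_iff_exists_two_mul.1 hV
  cases isEmpty_or_nonempty V with
  | inl _ => exact isEquipartite_of_forall_not_adj fun a => isEmptyElim a
  | inr hne =>
    have hd := fun v => h.degree_eq hV v hne.some
    by_cases hlt : G.degree hne.some < n
    · exact h.isEquipartite_of_degree_lt hn hd hlt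
    · have hpos : 0 < Fintype.card V := Fintype.card_pos
      -- If `d ≥ n`, the complement has degree `2n - 1 - d`, which is less than `n` as `n > 0`.
      refine IsEquipartite.of_compl (h.compl.isEquipartite_of_degree_lt hn (fun v => ?_) (d :=
        Fintype.card V - 1 - G.degree hne.some) (by omega))
      rw [degree_compl, hd]

omit [DecidableRel G.Adj] in
lemma IsEquipartite.isWeaklyEquipartite (h : G.IsEquipartite) : G.IsWeaklyEquipartite := by
  intro A hA
  obtain ⟨f, hf⟩ := h A hA
  rw [← hf]
  exact ⟨⟨f.toEquiv.image _, fun {a b} => f.map_adj_iff⟩⟩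

lemma IsWeaklyEquipartite.isDegreeEquipartite (h : G.IsWeaklyEquipartite) :
    G.IsDegreeEquipartite := by
  intro A hA
  obtain ⟨f⟩ := h A hA
  unfold degreeSeq
  rw [← Finset.map_univ_equiv f.toEquiv, Finset.map_val, Multiset.map_map]
  refine Multiset.map_congr rfl fun a _ => ?_
  exact (f.degree_eq a).symm

end Main

end SimpleGraph

theorem theorem4 {V : Type*} [Fintype V] [DecidableEq V] (G : SimpleGraph V)
    [DecidableRel G.Adj] (hV : Even (Fintype.card V)) :
    (G.IsDegreeEquipartite ↔ G.IsWeaklyEquipartite) ∧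
      (G.IsDegreeEquipartite → G.IsEquipartite) :=
  ⟨⟨fun h => (h.isEquipartite hV).isWeaklyEquipartite, fun h => h.isDegreeEquipartite⟩,
    fun h => h.isEquipartite hV⟩
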